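/- Let $A\in\mathbb R^{m\times m}$ be Hurwitz stable (all eigenvalues in the open left half-plane), let $B,q\in\mathbb R^{m}$ be columns, $C\in\mathbb R^{1\times m}$ a row, $\psi\in\mathbb R$, and let $T,\sigma_1,\sigma_*>0$. Consider the closed-loop pulse-width modulated system $$\frac{dx}{dt}=Ax+Bf+q,\qquad \sigma=Cx+\psi,\qquad f=M\sigma,\qquad t\ge 0,$$ where the modulator $M$ acts as follows: $f(t)=1$ for $nT\le t<nT+\tau_n$ and $f(t)=0$ for $nT+\tau_n\le t<(n+1)T$, $n=0,1,2,\dots$, and the pulse width $\tau_n\in[0,T]$ is $\tau_n=0$ if $\sigma(nT)\le\sigma_1$; $\tau_n=T$ if $\sigma(nT+\tau)>\sigma_1+\sigma_*\tau/T$ for all $0\le\tau\le T$; and otherwise $\tau_n$ is the smallest $\tau\in[0,T]$ with $\sigma(nT+\tau)=\sigma_1+\sigma_*\tau/T$. A solution is a continuous function $x$ on $[0,\infty)$ that satisfies the differential equation at every $t\ge 0$, the derivative at the switching instants being understood as the right derivative. Let $x^0(t)$ be a $T$-periodic solution, with modulator input $\sigma^0=Cx^0+\psi$ and pulse width $\tau^0$,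 and let $L_1>0$ be a constant such that $|d\sigma^0(t)/dt|\le L_1$ at all $t>0$ at which $\sigma^0$ is differentiable. Put $\kappa=-CB$, $\kappa_1=-CAB$, $\kappa_2=T/\pi$ and $$L(H)=\begin{bmatrix}HA+A^\top H&HAB&HB&0\\ B^\top A^\top H&0&0&0\\ B^\top H&0&0&0\\ 0&0&0&0\end{bmatrix},$$ $$R(\varepsilon,\nu)=\begin{bmatrix}0&0&-\frac12C^\top&\kappa_2A^\top C^\top\\ 0&3\nu/T^2&0&-\kappa_2\kappa_1\\ -\frac12C&0&\sigma_*-TL_1-\nu-\varepsilon-T|\kappa|&-\kappa_2\kappa\\ \kappa_2CA&-\kappa_2\kappa_1&-\kappa_2\kappa&\varepsilon\end{bmatrix}.$$ Suppose that there exist a symmetric $m\times m$ matrix $H$ and scalars $\varepsilon,\nu$ such that $R(\varepsilon,\nu)-L(H)$ and $H$ are positive definite, $\nu>0$ and $\varepsilon>0$. Then every solution $x(t)$, with pulse widths $\tau_n$, satisfies $$\lim_{t\to+\infty}[x(t)-x^0(t)]=0,\qquad \lim_{n\to\infty}\tau_n=\tau^0.$$ Moreover, $x^0$ is stable in the sense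 of Lyapunov: for every $\eta>0$ there is $\delta>0$ such that every solution $x$ with $\|x(0)-x^0(0)\|<\delta$ satisfies $\|x(t)-x^0(t)\|<\eta$ for all $t\ge0$. -/

import Mathlib

open Set Filter Topology Matrix

/-- Data of the closed loop system `dx/dt = A x + B f + q`, `σ = C x + ψ`, `f = M σ`, with state
dimension `m`.  `B`, `q` are columns and `C` is a row; `T` is the switching period, and the ramp of
the modulator rises from `σ₁` to `σ₁ + σs` over each period. -/
structure PWMSystem (m : ℕ) where
  A : Matrix (Fin m) (Fin m) ℝ
  B : Fin m → ℝ
  q : Fin m → ℝ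
  C : Fin m → ℝ
  ψ : ℝ
  T : ℝ
  σ₁ : ℝ
  σs : ℝ
  T_pos : 0 < T
  σ₁_pos : 0 < σ₁
  σs_pos : 0 < σs
  /-- `A` is Hurwitz stable: all its complex eigenvalues have negative real part. -/
  hurwitz : ∀ z ∈ spectrum ℂ (A.map (algebraMap ℝ ℂ)), z.re < 0

namespace PWMSystem

variable {m : ℕ}

/-- The ramp `σ₁ + σs s / T`, where `s ∈ [0, T]` is the time since the beginning of the period. -/
noncomputable def ramp (S : PWMSystem m) (s : ℝ) : ℝ := S.σ₁ + S.σs * s / S.T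

open Classical in
/-- The pulse width `τₙ` that the modulator assigns to the input `σ` on the `n`-th period:
`0` if `σ(nT) ≤ σ₁`; `T` if `σ` stays above the ramp on the whole closed period; otherwise the
smallest `s ∈ [0, T]` at which `σ` meets the ramp. -/
noncomputable def pulseWidth (S : PWMSystem m) (σ : ℝ → ℝ) (n : ℕ) : ℝ :=
  if σ (n * S.T) ≤ S.σ₁ then 0
  else if ∀ s ∈ Icc 0 S.T, S.ramp s < σ (n * S.T + s) then S.T
  else sInf {s | s ∈ Icc 0 S.T ∧ σ (n * S.T + s) = S.ramp s}

/-- For a continuous input the infimum in `pulseWidth` is attained, so it is a minimum. -/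
theorem pulseWidth_isLeast (S : PWMSystem m) (σ : ℝ → ℝ) (hσ : ContinuousOn σ (Ici 0)) (n : ℕ)
    (h0 : ¬ σ (n * S.T) ≤ S.σ₁) (h1 : ¬ ∀ s ∈ Icc 0 S.T, S.ramp s < σ (n * S.T + s)) :
    IsLeast {s | s ∈ Icc 0 S.T ∧ σ (n * S.T + s) = S.ramp s} (S.pulseWidth σ n) := by
  have hT := S.T_pos
  rw [pulseWidth, if_neg h0, if_neg h1]
  have hc : ContinuousOn (fun s => σ (n * S.T + s) - S.ramp s) (Icc 0 S.T) := by
    refine ContinuousOn.sub (hσ.comp (by fun_prop) ?_) ?_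
    · intro s hs
      have : (0 : ℝ) ≤ n * S.T := by positivity
      exact add_nonneg this hs.1
    · unfold ramp
      fun_prop
  have hset : {s | s ∈ Icc 0 S.T ∧ σ (n * S.T + s) = S.ramp s} =
      Icc 0 S.T ∩ (fun s => σ (n * S.T + s) - S.ramp s) ⁻¹' {0} := by
    ext s
    simp [sub_eq_zero]
  have hclosed : IsClosed {s | s ∈ Icc 0 S.T ∧ σ (n * S.T + s) = S.ramp s} := by
    rw [hset]
    exact hc.preimage_isClosed_of_isClosed isClosed_Icc isClosed_singleton
  have hne : {s | s ∈ Icc 0 S.T ∧ σ (n * S.T + s) = S.ramp s}.Nonempty := by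
    push Not at h0 h1
    obtain ⟨s, hs, hle⟩ := h1
    have hc' := hc.mono (Icc_subset_Icc_right hs.2)
    have hmem : (0 : ℝ) ∈ Icc (σ (n * S.T + s) - S.ramp s) (σ (n * S.T + 0) - S.ramp 0) := by
      constructor
      · linarith
      · simp only [ramp, add_zero, mul_zero, zero_div]
        linarith
    obtain ⟨r, hr, hr0⟩ := intermediate_value_Icc' hs.1 hc' hmem
    exact ⟨r, ⟨hr.1, hr.2.trans hs.2⟩, sub_eq_zero.mp hr0⟩
  exact hclosed.isLeast_csInf hne ⟨0, fun s hs => hs.1.1⟩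

/-- The modulator `M`: for `t ≥ 0` lying in the `n`-th period `[nT, (n+1)T)`, the output `(M σ)(t)`
is `1` if `t < nT + τₙ` and `0` otherwise. -/
noncomputable def modulator (S : PWMSystem m) (σ : ℝ → ℝ) (t : ℝ) : ℝ :=
  if t < (⌊t / S.T⌋₊ : ℝ) * S.T + S.pulseWidth σ ⌊t / S.T⌋₊ then 1 else 0

/-- The modulator input `σ = C x + ψ` along a trajectory `x`. -/
def input (S : PWMSystem m) (x : ℝ → Fin m → ℝ) (t : ℝ) : ℝ := S.C ⬝ᵥ x t + S.ψ

/-- `x` is a solution of the closed loop system on `[0, ∞)` (values at negative times are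
irrelevant).  It is continuous and, since the pulse train `f = M σ` is right-continuous and
piecewise constant, the differential equation is imposed through the right derivative, which also
makes sense at the switching instants; between them it is equivalent to the ordinary derivative. -/
structure IsSolution (S : PWMSystem m) (x : ℝ → Fin m → ℝ) : Prop where
  continuousOn : ContinuousOn x (Ici 0)
  hasDeriv : ∀ t, 0 ≤ t →
    HasDerivWithinAt x (S.A *ᵥ x t + S.modulator (S.input x) t • S.B + S.q) (Ici t) t

/-- Lyapunov stability of the solution `x₀` on `[0, ∞)`. -/
def LyapunovStable (S : PWMSystem m) (x₀ : ℝ → Fin m → ℝ) : Prop :=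
  ∀ η > 0, ∃ δ > 0, ∀ x, S.IsSolution x → ‖x 0 - x₀ 0‖ < δ → ∀ t, 0 ≤ t → ‖x t - x₀ t‖ < η

/-- `κ = -CB`. -/
def kappa (S : PWMSystem m) : ℝ := -(S.C ⬝ᵥ S.B)

/-- `κ₁ = -CAB`. -/
def kappaOne (S : PWMSystem m) : ℝ := -(S.C ⬝ᵥ (S.A *ᵥ S.B))

/-- `κ₂ = T/π`. -/
noncomputable def kappaTwo (S : PWMSystem m) : ℝ := S.T / Real.pi

/-- The block matrix `L(H)`, of size `m + 3`. -/
def lmiL (S : PWMSystem m) (H : Matrix (Fin m) (Fin m) ℝ) :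
    Matrix (Fin m ⊕ Fin 3) (Fin m ⊕ Fin 3) ℝ :=
  Matrix.fromBlocks
    (H * S.A + S.Aᵀ * H)
    (Matrix.of ![(H * S.A) *ᵥ S.B, H *ᵥ S.B, 0])ᵀ
    (Matrix.of ![S.B ᵥ* (S.Aᵀ * H), S.B ᵥ* H, 0])
    0

/-- The block matrix `R(ε, ν)`, of size `m + 3`. -/
noncomputable def lmiR (S : PWMSystem m) (L₁ ε ν : ℝ) :
    Matrix (Fin m ⊕ Fin 3) (Fin m ⊕ Fin 3) ℝ :=
  Matrix.fromBlocks
    0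
    (Matrix.of ![0, -(1 / 2 : ℝ) • S.C, S.kappaTwo • (S.Aᵀ *ᵥ S.C)])ᵀ
    (Matrix.of ![0, -(1 / 2 : ℝ) • S.C, S.kappaTwo • (S.C ᵥ* S.A)])
    !![3 * ν / S.T ^ 2, 0, -(S.kappaTwo * S.kappaOne);
       0, S.σs - S.T * L₁ - ν - ε - S.T * |S.kappa|, -(S.kappaTwo * S.kappa);
       -(S.kappaTwo * S.kappaOne), -(S.kappaTwo * S.kappa), ε]

end PWMSystem

/-! The difference of two solutions is driven by the difference of two pulse trains. On each period
this forcing is replaced by its mean `v = (τ - τ₀)/T`. Its deviation from the mean integrates to the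
ripple `u`, which vanishes at both ends of the period, so `z = x - x₀ - u B` is continuous across
periods, equals `x - x₀` at the sampling times, and satisfies `z' = A z + u A B + v B`
(`averagedField`).

Let `V = zᵀHz` and `g = C z`. The form of `lmiL` is `V'`, so positivity of `lmiR - lmiL` bounds `V +
v²` by a multiple of (form of `lmiR`) `- V'`, for every value of the last variable `w`. The choice
`w = -κ₂ g'/ε` minimises that form. Its integral over a period is then nonpositive, for three
reasons: `∫ u² ≤ T³v²/3` (`integral_sq_pulseRipple_le`); the sector condition `(σ_* - T L₁) v² ≤ v
(σ - σ⁰)` at the end of the perturbed pulse (`IsSolution.pulse_sector`); and Wirtinger's inequality,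
which controls `g` away from that instant (`integral_sq_le_wirtinger`). Hence `∫ (V + v²) ≤ c (V(0)
- V(T))`.

Since also `V' ≤ K' (V + v²)`, this gives `V(T) ≤ r V(0)` with `r < 1` independent of the solution
and of the period, and bounds `V` inside the period and `v²` by multiples of `V(0)`. The result is
exponential convergence with uniform constants, from which all the claims follow. Periodicity of
`x₀` serves only to make its pulse width constant. -/

/-- A positive definite quadratic form dominates every quadratic form. -/
theorem Matrix.PosDef.exists_form_le {ι : Type*} [Fintype ι] [DecidableEq ι] {P : Matrix ι ι ℝ}
    (hP : P.PosDef) (M : Matrix ι ι ℝ) :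
    ∃ c > 0, ∀ v : ι → ℝ, v ⬝ᵥ (M *ᵥ v) ≤ c * (v ⬝ᵥ (P *ᵥ v)) := by
  have hpos : ∀ v : ι → ℝ, v ≠ 0 → 0 < v ⬝ᵥ (P *ᵥ v) := fun v hv => by
    simpa using hP.dotProduct_mulVec_pos hv
  have hcont : ∀ N : Matrix ι ι ℝ, Continuous fun v : ι → ℝ => v ⬝ᵥ (N *ᵥ v) := fun N => by
    simp only [dotProduct, mulVec]
    fun_prop
  have hscale : ∀ (N : Matrix ι ι ℝ) (r : ℝ) (v : ι → ℝ),
      (r • v) ⬝ᵥ (N *ᵥ (r • v)) = r ^ 2 * (v ⬝ᵥ (N *ᵥ v)) := fun N r v => by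
    rw [mulVec_smul, smul_dotProduct, dotProduct_smul, smul_eq_mul, smul_eq_mul]
    ring
  have hK : IsCompact (Metric.sphere (0 : ι → ℝ) 1) := isCompact_sphere 0 1
  have hne : ∀ v ∈ Metric.sphere (0 : ι → ℝ) 1, v ≠ 0 := by
    intro v hv h0
    simp [h0] at hv
  have hq : ContinuousOn (fun v : ι → ℝ => (v ⬝ᵥ (M *ᵥ v)) / (v ⬝ᵥ (P *ᵥ v)))
      (Metric.sphere 0 1) :=
    (hcont M).continuousOn.div (hcont P).continuousOn fun v hv => (hpos v (hne v hv)).ne'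
  obtain ⟨c, hc⟩ := hK.bddAbove_image hq
  refine ⟨max c 1, by positivity, fun v => ?_⟩
  rcases eq_or_ne v 0 with rfl | hv
  · simp
  have hnv : 0 < ‖v‖ := norm_pos_iff.2 hv
  have hmem : ‖v‖⁻¹ • v ∈ Metric.sphere (0 : ι → ℝ) 1 := by
    simp [norm_smul, hnv.ne']
  have h1 := hc ⟨_, hmem, rfl⟩
  simp only [hscale] at h1
  have hr : 0 < ‖v‖⁻¹ ^ 2 := by positivity
  rw [mul_div_mul_left _ _ hr.ne', div_le_iff₀ (hpos v hv)] at h1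
  exact h1.trans (mul_le_mul_of_nonneg_right (le_max_left _ _) (hpos v hv).le)

/-! ### Calculus with right derivatives and Wirtinger's inequality -/

/-- Fundamental theorem of calculus for right derivatives. -/
theorem integral_rightDeriv_eq_sub {a b : ℝ} (hab : a ≤ b) {f f' : ℝ → ℝ}
    (hf : ContinuousOn f (Icc a b)) (hf' : ContinuousOn f' (Icc a b))
    (hd : ∀ t ∈ Ioo a b, HasDerivWithinAt f (f' t) (Ici t) t) :
    ∫ t in a..b, f' t = f b - f a :=
  intervalIntegral.integral_eq_sub_of_hasDeriv_right_of_le hab hf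
    (fun t ht => (hd t ht).mono Ioi_subset_Ici_self)
    (hf'.intervalIntegrable_of_Icc hab)

theorem integral_mono_of_continuousOn {a b : ℝ} (hab : a ≤ b) {f g : ℝ → ℝ}
    (hf : ContinuousOn f (Icc a b)) (hg : ContinuousOn g (Icc a b))
    (h : ∀ t ∈ Icc a b, f t ≤ g t) : ∫ t in a..b, f t ≤ ∫ t in a..b, g t :=
  intervalIntegral.integral_mono_on hab (hf.intervalIntegrable_of_Icc hab)
    (hg.intervalIntegrable_of_Icc hab) h

/-- A continuous function with a continuous right derivative is differentiable. -/
theorem hasDerivAt_of_continuousOn_rightDeriv {a b : ℝ} {f f' : ℝ → ℝ}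
    (hf : ContinuousOn f (Icc a b)) (hf' : ContinuousOn f' (Icc a b))
    (hd : ∀ t ∈ Ioo a b, HasDerivWithinAt f (f' t) (Ici t) t) {t : ℝ} (ht : t ∈ Ioo a b) :
    HasDerivAt f (f' t) t := by
  have hab : a ≤ b := (ht.1.trans ht.2).le
  have hint : IntervalIntegrable f' MeasureTheory.volume a t :=
    (hf'.mono (Icc_subset_Icc_right ht.2.le)).intervalIntegrable_of_Icc ht.1.le
  have hF : HasDerivAt (fun s => ∫ r in a..s, f' r) (f' t) t :=
    intervalIntegral.integral_hasDerivAt_right hint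
      ((hf'.mono Ioo_subset_Icc_self).stronglyMeasurableAtFilter isOpen_Ioo t ht)
      (hf'.continuousAt (Icc_mem_nhds ht.1 ht.2))
  refine (hF.add_const (f a)).congr_of_eventuallyEq ?_
  filter_upwards [Icc_mem_nhds ht.1 ht.2] with s hs
  rw [integral_rightDeriv_eq_sub hs.1 (hf.mono (Icc_subset_Icc_right hs.2))
    (hf'.mono (Icc_subset_Icc_right hs.2)) fun r hr => hd r ⟨hr.1, hr.2.trans_le hs.2⟩]
  ring

/-- The Riccati substitution: if `p' = -k² - p²` and `p g²` vanishes at both ends, then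
`k² ∫ g² ≤ ∫ g'²`. -/
theorem sq_mul_integral_sq_le_of_riccati {a b k : ℝ} (hab : a ≤ b) {g g' p : ℝ → ℝ}
    (hg : ContinuousOn g (Icc a b)) (hg' : ContinuousOn g' (Icc a b))
    (hd : ∀ t ∈ Ioo a b, HasDerivWithinAt g (g' t) (Ici t) t)
    (hp : ∀ t ∈ Icc a b, HasDerivAt p (-k ^ 2 - p t ^ 2) t)
    (ha : p a * g a ^ 2 = 0) (hb : p b * g b ^ 2 = 0) :
    k ^ 2 * ∫ t in a..b, g t ^ 2 ≤ ∫ t in a..b, g' t ^ 2 := by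
  have hpc : ContinuousOn p (Icc a b) := fun t ht => (hp t ht).continuousAt.continuousWithinAt
  have h1 := integral_rightDeriv_eq_sub (f := fun t => p t * g t ^ 2)
    (f' := fun t => (-k ^ 2 - p t ^ 2) * g t ^ 2 + p t * (2 * g t * g' t)) hab
    (by fun_prop) (by fun_prop) (fun t ht => by
      have := (hp t ⟨ht.1.le, ht.2.le⟩).hasDerivWithinAt (s := Ici t)
      have h2 := this.fun_mul ((hd t ht).fun_pow 2)
      simpa using h2)
  rw [ha, hb, sub_zero] at h1
  -- Completing the square: `k²g² + (p g²)' = g'² - (g' - p g)²`.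
  have h2 := integral_mono_of_continuousOn hab
    (f := fun t => k ^ 2 * g t ^ 2 + ((-k ^ 2 - p t ^ 2) * g t ^ 2 + p t * (2 * g t * g' t)))
    (g := fun t => g' t ^ 2) (by fun_prop) (by fun_prop)
    (fun t _ => by nlinarith [sq_nonneg (g' t - p t * g t)])
  rw [intervalIntegral.integral_add, h1, intervalIntegral.integral_const_mul, add_zero] at h2
  · exact h2
  · exact ContinuousOn.intervalIntegrable_of_Icc hab (by fun_prop)
  · exact ContinuousOn.intervalIntegrable_of_Icc hab (by fun_prop)

/-- Wirtinger's inequality on `[a, b]` for a function vanishing at one point `c` of `[a, b]`. -/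
theorem integral_sq_le_wirtinger {a b c : ℝ} (hab : a < b) (hc : c ∈ Icc a b) {g g' : ℝ → ℝ}
    (hg : ContinuousOn g (Icc a b)) (hg' : ContinuousOn g' (Icc a b))
    (hd : ∀ t ∈ Ioo a b, HasDerivWithinAt g (g' t) (Ici t) t) (h0 : g c = 0) :
    ∫ t in a..b, g t ^ 2 ≤ (2 * (b - a) / Real.pi) ^ 2 * ∫ t in a..b, g' t ^ 2 := by
  have hl : 0 < b - a := sub_pos.2 hab
  set K := Real.pi / (2 * (b - a)) with hKdef
  have hK : 0 < K := by positivity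
  -- For `k < K` the arguments of `tan` stay below `π/2` on both sides of `c`. Each Riccati solution
  -- vanishes at the outer endpoint, while `g` vanishes at `c`. The constant itself is reached by
  -- letting `k` tend to `K`.
  have key : ∀ k ∈ Ioo 0 K, k ^ 2 * ∫ t in a..b, g t ^ 2 ≤ ∫ t in a..b, g' t ^ 2 := by
    rintro k ⟨hk0, hkK⟩
    have hkl : k * (b - a) < Real.pi / 2 := by
      have : K * (b - a) = Real.pi / 2 := by rw [hKdef]; field_simp
      nlinarith
    have htan : ∀ s, 0 ≤ s → s ≤ b - a → HasDerivAt Real.tan (1 + Real.tan (k * s) ^ 2) (k * s) := by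
      intro s hs hs'
      have hcos : Real.cos (k * s) ≠ 0 := (Real.cos_pos_of_mem_Ioo
        ⟨by have := Real.pi_pos; nlinarith [mul_nonneg hk0.le hs],
          (mul_le_mul_of_nonneg_left hs' hk0.le).trans_lt hkl⟩).ne'
      convert Real.hasDerivAt_tan hcos using 1
      rw [Real.tan_eq_sin_div_cos]
      field_simp
      exact Real.cos_sq_add_sin_sq _
    have hleft := sq_mul_integral_sq_le_of_riccati (k := k) (p := fun t => -(k * Real.tan (k * (t - a))))
      hc.1 (hg.mono (Icc_subset_Icc_right hc.2)) (hg'.mono (Icc_subset_Icc_right hc.2))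
      (fun t ht => hd t ⟨ht.1, ht.2.trans_le hc.2⟩)
      (fun t ht => by
        have h1 : HasDerivAt (fun t => k * (t - a)) k t := by
          simpa using ((hasDerivAt_id t).sub_const a).const_mul k
        have h2 := (((htan (t - a) (by linarith [ht.1]) (by linarith [ht.2, hc.2])).comp t
          h1).const_mul k).fun_neg
        refine h2.congr_deriv ?_
        ring) (by simp) (by simp [h0])
    have hright := sq_mul_integral_sq_le_of_riccati (k := k) (p := fun t => k * Real.tan (k * (b - t)))
      hc.2 (hg.mono (Icc_subset_Icc_left hc.1)) (hg'.mono (Icc_subset_Icc_left hc.1))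
      (fun t ht => hd t ⟨hc.1.trans_lt ht.1, ht.2⟩)
      (fun t ht => by
        have h1 : HasDerivAt (fun t => k * (b - t)) (-k) t := by
          simpa using ((hasDerivAt_id t).const_sub b).const_mul k
        have h2 := ((htan (b - t) (by linarith [ht.2]) (by linarith [ht.1, hc.1])).comp t
          h1).const_mul k
        refine h2.congr_deriv ?_
        ring) (by simp [h0]) (by simp)
    have hi : ∀ f : ℝ → ℝ, ContinuousOn f (Icc a b) →
        (∫ t in a..c, f t) + ∫ t in c..b, f t = ∫ t in a..b, f t := fun f hf =>
      intervalIntegral.integral_add_adjacent_intervals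
        ((hf.mono (Icc_subset_Icc_right hc.2)).intervalIntegrable_of_Icc hc.1)
        ((hf.mono (Icc_subset_Icc_left hc.1)).intervalIntegrable_of_Icc hc.2)
    rw [← hi (fun t => g t ^ 2) (hg.pow 2), ← hi (fun t => g' t ^ 2) (hg'.pow 2), mul_add]
    exact add_le_add hleft hright
  have hlim : K ^ 2 * ∫ t in a..b, g t ^ 2 ≤ ∫ t in a..b, g' t ^ 2 := by
    have ht : Tendsto (fun k : ℝ => k ^ 2 * ∫ t in a..b, g t ^ 2) (𝓝[<] K)
        (𝓝 (K ^ 2 * ∫ t in a..b, g t ^ 2)) :=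
      (Continuous.tendsto (by fun_prop) K).mono_left nhdsWithin_le_nhds
    exact le_of_tendsto ht (eventually_of_mem (Ioo_mem_nhdsLT hK) key)
  have hKinv : (2 * (b - a) / Real.pi) ^ 2 * K ^ 2 = 1 := by
    rw [hKdef]; field_simp
  calc ∫ t in a..b, g t ^ 2 = (2 * (b - a) / Real.pi) ^ 2 * (K ^ 2 * ∫ t in a..b, g t ^ 2) := by
        rw [← mul_assoc, hKinv, one_mul]
    _ ≤ _ := mul_le_mul_of_nonneg_left hlim (by positivity)

/-! ### The ripple of a difference of pulses -/

/-- The deviation of the accumulated difference of two pulses of widths `τ` and `τ₀` from its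
average, at time `s` of a period of length `T`. -/
noncomputable def pulseRipple (T τ τ₀ s : ℝ) : ℝ := min s τ - min s τ₀ - (τ - τ₀) / T * s

theorem continuous_pulseRipple (T τ τ₀ : ℝ) : Continuous (pulseRipple T τ τ₀) := by
  unfold pulseRipple
  fun_prop

/-- The right derivative is the pulse itself, with value `0` at `s = τ`, in agreement with the
strict inequality in `modulator`. -/
theorem hasDerivWithinAt_min_const (s τ : ℝ) :
    HasDerivWithinAt (fun r => min r τ) (if s < τ then 1 else 0) (Ici s) s := by
  split_ifs with h
  · refine ((hasDerivAt_id s).congr_of_eventuallyEq ?_).hasDerivWithinAt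
    filter_upwards [Iio_mem_nhds h] with r hr
    exact min_eq_left hr.le
  · refine (hasDerivWithinAt_const s (Ici s) τ).congr (fun r hr => ?_) ?_
    · exact min_eq_right ((not_lt.1 h).trans hr)
    · exact min_eq_right (not_lt.1 h)

theorem hasDerivWithinAt_pulseRipple (T τ τ₀ s : ℝ) :
    HasDerivWithinAt (pulseRipple T τ τ₀)
      ((if s < τ then 1 else 0) - (if s < τ₀ then 1 else 0) - (τ - τ₀) / T) (Ici s) s := by
  have h := ((hasDerivWithinAt_min_const s τ).fun_sub (hasDerivWithinAt_min_const s τ₀)).fun_sub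
    (((hasDerivAt_id s).const_mul ((τ - τ₀) / T)).hasDerivWithinAt (s := Ici s))
  rw [mul_one] at h
  exact h

section
variable {T τ τ₀ : ℝ}

theorem pulseRipple_zero (hτ : 0 ≤ τ) (hτ₀ : 0 ≤ τ₀) : pulseRipple T τ τ₀ 0 = 0 := by
  simp [pulseRipple, hτ, hτ₀]

theorem pulseRipple_period (hT : 0 < T) (hτ : τ ≤ T) (hτ₀ : τ₀ ≤ T) :
    pulseRipple T τ τ₀ T = 0 := by
  rw [pulseRipple, min_eq_right hτ, min_eq_right hτ₀]
  field_simp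
  ring

theorem abs_pulseRipple_le (hT : 0 < T) {s : ℝ}
    (hs : s ∈ Icc 0 T) : |pulseRipple T τ τ₀ s| ≤ T * |(τ - τ₀) / T| := by
  obtain ⟨h0, h1⟩ := hs
  have hr : 0 ≤ s / T ∧ s / T ≤ 1 := ⟨by positivity, (div_le_one hT).2 h1⟩
  have e : T * |(τ - τ₀) / T| = |τ - τ₀| := by
    rw [abs_div, abs_of_pos hT]; field_simp
  have e2 : (τ - τ₀) / T * s = (τ - τ₀) * (s / T) := by ring
  rw [e, pulseRipple, e2]
  generalize s / T = r at hr
  rcases le_total τ₀ τ with h | h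
  · rw [abs_of_nonneg (sub_nonneg.2 h), abs_le]
    have m1 := min_le_min_left s h
    have m2 : min s τ - min s τ₀ ≤ τ - τ₀ := by
      rcases min_cases s τ with ⟨e, _⟩ | ⟨e, _⟩ <;> rcases min_cases s τ₀ with ⟨e', _⟩ | ⟨e', _⟩ <;>
        rw [e, e'] <;> linarith
    constructor <;> nlinarith
  · rw [abs_of_nonpos (sub_nonpos.2 h), abs_le]
    have m1 := min_le_min_left s h
    have m2 : min s τ₀ - min s τ ≤ τ₀ - τ := by
      rcases min_cases s τ with ⟨e, _⟩ | ⟨e, _⟩ <;> rcases min_cases s τ₀ with ⟨e', _⟩ | ⟨e', _⟩ <;>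
        rw [e, e'] <;> linarith
    constructor <;> nlinarith

theorem min_sub_min_mem (h : τ₀ ≤ τ) {r s : ℝ} (hrs : r ≤ s) :
    0 ≤ min r τ - min r τ₀ ∧ min r τ - min r τ₀ ≤ min s τ - min s τ₀ ∧
      min s τ - min s τ₀ ≤ τ - τ₀ := by
  rcases min_cases s τ with ⟨e, _⟩ | ⟨e, _⟩ <;> rcases min_cases s τ₀ with ⟨e', _⟩ | ⟨e', _⟩ <;>
  rcases min_cases r τ with ⟨d, _⟩ | ⟨d, _⟩ <;> rcases min_cases r τ₀ with ⟨d', _⟩ | ⟨d', _⟩ <;>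
        rw [e, e', d, d'] <;> refine ⟨?_, ?_, ?_⟩ <;> linarith

/-- Let `a = min s τ - min s τ₀` and `Δ = τ - τ₀`, so `0 ≤ a ≤ Δ`. After expansion, `a² ≤ aΔ` leaves
`aΔ(1 - 2s/T)`. As `a` is monotone in `s` and `1 - 2s/T` changes sign at `T/2`, `a` may be replaced
by its value there. The resulting term integrates to zero over the period. -/
theorem sq_pulseRipple_le (hT : 0 < T) (h : τ₀ ≤ τ) (s : ℝ) :
    pulseRipple T τ τ₀ s ^ 2 ≤
      (min (T / 2) τ - min (T / 2) τ₀) * (τ - τ₀) * (1 - 2 / T * s) + ((τ - τ₀) / T) ^ 2 * s ^ 2 := by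
  have e2 : (τ - τ₀) / T * s = (τ - τ₀) * (s / T) := by ring
  have e3 : ((τ - τ₀) / T) ^ 2 * s ^ 2 = (τ - τ₀) ^ 2 * (s / T) ^ 2 := by ring
  have e4 : 2 / T * s = 2 * (s / T) := by ring
  rw [pulseRipple, e2, e3, e4]
  rcases le_total s (T / 2) with hs | hs
  · obtain ⟨a1, a2, a3⟩ := min_sub_min_mem h hs
    have hr : s / T ≤ 1 / 2 := by rw [div_le_iff₀ hT]; linarith
    have b1 := mul_nonneg a1 (sub_nonneg.2 (a2.trans a3))
    have b2 := mul_nonneg (mul_nonneg (sub_nonneg.2 a2) (sub_nonneg.2 hr)) (sub_nonneg.2 h)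
    nlinarith
  · obtain ⟨a1, a2, a3⟩ := min_sub_min_mem h hs
    have hr : 1 / 2 ≤ s / T := by rw [le_div_iff₀ hT]; linarith
    have b1 := mul_nonneg (a1.trans a2) (sub_nonneg.2 a3)
    have b2 := mul_nonneg (mul_nonneg (sub_nonneg.2 a2) (sub_nonneg.2 hr)) (sub_nonneg.2 h)
    nlinarith

theorem pulseRipple_swap (T τ τ₀ s : ℝ) : pulseRipple T τ τ₀ s = -pulseRipple T τ₀ τ s := by
  unfold pulseRipple
  ring

theorem integral_sq_pulseRipple_le (hT : 0 < T) (τ τ₀ : ℝ) :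
    ∫ s in 0..T, pulseRipple T τ τ₀ s ^ 2 ≤ T ^ 3 / 3 * ((τ - τ₀) / T) ^ 2 := by
  wlog h : τ₀ ≤ τ generalizing τ τ₀
  · have := this τ₀ τ (le_of_not_ge h)
    simp_rw [pulseRipple_swap T τ τ₀, neg_sq]
    refine this.trans_eq ?_
    ring
  have hc := continuous_pulseRipple T τ τ₀
  refine (integral_mono_of_continuousOn hT.le (by fun_prop) (by fun_prop)
    fun s _ => sq_pulseRipple_le hT h s).trans_eq ?_
  rw [intervalIntegral.integral_add (Continuous.intervalIntegrable (by fun_prop) _ _)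
    (Continuous.intervalIntegrable (by fun_prop) _ _), intervalIntegral.integral_const_mul,
    intervalIntegral.integral_const_mul, intervalIntegral.integral_sub
    (Continuous.intervalIntegrable (by fun_prop) _ _)
    (Continuous.intervalIntegrable (by fun_prop) _ _), intervalIntegral.integral_const_mul,
    integral_id, integral_pow]
  simp
  field_simp
  ring

end

/-! ### The quadratic forms of the matrix inequality -/

/-- The quadratic form of a block matrix bordered by three rows and columns. -/
theorem bordered_form {m : ℕ} (P : Matrix (Fin m) (Fin m) ℝ) (a b c a' b' c' : Fin m → ℝ)
    (D : Matrix (Fin 3) (Fin 3) ℝ) (z : Fin m → ℝ) (u v w : ℝ) :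
    Sum.elim z ![u, v, w] ⬝ᵥ (Matrix.fromBlocks P (Matrix.of ![a, b, c])ᵀ (Matrix.of ![a', b', c'])
        D *ᵥ Sum.elim z ![u, v, w]) =
      z ⬝ᵥ (P *ᵥ z) + (u * (a ⬝ᵥ z) + v * (b ⬝ᵥ z) + w * (c ⬝ᵥ z)) +
        (u * (a' ⬝ᵥ z) + v * (b' ⬝ᵥ z) + w * (c' ⬝ᵥ z)) +
        ![u, v, w] ⬝ᵥ (D *ᵥ ![u, v, w]) := by
  rw [fromBlocks_mulVec, sumElim_dotProduct_sumElim, dotProduct_add, dotProduct_add,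
    Sum.elim_comp_inl, Sum.elim_comp_inr, dotProduct_mulVec z (Matrix.of _)ᵀ, vecMul_transpose]
  simp
  ring

namespace PWMSystem
variable {m : ℕ} (S : PWMSystem m)

/-- The last bracket is `C` applied to `averagedField`, that is, the derivative of `C z`; so `w`
multiplies exactly this derivative. -/
theorem lmiR_form (L₁ ε ν : ℝ) (z : Fin m → ℝ) (u v w : ℝ) :
    Sum.elim z ![u, v, w] ⬝ᵥ (S.lmiR L₁ ε ν *ᵥ Sum.elim z ![u, v, w]) =
      3 * ν / S.T ^ 2 * u ^ 2 - v * (S.C ⬝ᵥ z) +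
        (S.σs - S.T * L₁ - ν - ε - S.T * |S.kappa|) * v ^ 2 + ε * w ^ 2 +
        2 * S.kappaTwo * w * (S.C ⬝ᵥ (S.A *ᵥ z) - S.kappaOne * u - S.kappa * v) := by
  rw [lmiR, bordered_form, mulVec_transpose]
  simp only [zero_mulVec, dotProduct_zero, zero_dotProduct, smul_dotProduct, smul_eq_mul,
    ← dotProduct_mulVec]
  simp only [Matrix.mulVec, vec3_dotProduct, Matrix.of_apply, Matrix.cons_val]
  ring

/-- This is the derivative of `zᵀHz` along `averagedField`; it does not involve `w`. -/
theorem lmiL_form (H : Matrix (Fin m) (Fin m) ℝ) (z : Fin m → ℝ) (u v w : ℝ) :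
    Sum.elim z ![u, v, w] ⬝ᵥ (S.lmiL H *ᵥ Sum.elim z ![u, v, w]) =
      (S.A *ᵥ z + u • (S.A *ᵥ S.B) + v • S.B) ⬝ᵥ (H *ᵥ z) +
        z ⬝ᵥ (H *ᵥ (S.A *ᵥ z + u • (S.A *ᵥ S.B) + v • S.B)) := by
  rw [lmiL, bordered_form]
  have e1 : z ⬝ᵥ (S.Aᵀ *ᵥ (H *ᵥ z)) = (S.A *ᵥ z) ⬝ᵥ (H *ᵥ z) := by
    rw [dotProduct_mulVec, vecMul_transpose]
  have e2 : (S.B ᵥ* (S.Aᵀ * H)) ⬝ᵥ z = (S.A *ᵥ S.B) ⬝ᵥ (H *ᵥ z) := by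
    rw [← dotProduct_mulVec, ← mulVec_mulVec, dotProduct_mulVec, vecMul_transpose]
  simp only [add_mulVec, dotProduct_add, add_dotProduct, mulVec_add, mulVec_smul, dotProduct_smul,
    smul_dotProduct, smul_eq_mul, zero_mulVec, dotProduct_zero, e2,
    dotProduct_comm _ z, ← mulVec_mulVec]
  rw [dotProduct_comm z (S.B ᵥ* H), ← dotProduct_mulVec, e1]
  ring

/-- The velocity of `z = y - u B`, where `y` is the difference of two solutions and `u` the
ripple of the difference of their pulse trains. -/
def averagedField (z : Fin m → ℝ) (u v : ℝ) : Fin m → ℝ :=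
  S.A *ᵥ z + u • (S.A *ᵥ S.B) + v • S.B

/-- Each bound is a comparison with a positive definite form: `lmiR - lmiL` for the first, the block
sum of `H` and the identity for the second, `H` and the identity for the norm equivalence. -/
theorem exists_lyapunov_bounds {H : Matrix (Fin m) (Fin m) ℝ} {L₁ ε ν : ℝ} (hH : H.PosDef)
    (hQ : (S.lmiR L₁ ε ν - S.lmiL H).PosDef) :
    ∃ c > 0, ∃ K > 0, ∃ b > 0, (∀ (z : Fin m → ℝ) (u v w : ℝ),
      z ⬝ᵥ (H *ᵥ z) + v ^ 2 ≤
        c * (3 * ν / S.T ^ 2 * u ^ 2 - v * (S.C ⬝ᵥ z) +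
          (S.σs - S.T * L₁ - ν - ε - S.T * |S.kappa|) * v ^ 2 + ε * w ^ 2 +
          2 * S.kappaTwo * w * (S.C ⬝ᵥ (S.A *ᵥ z) - S.kappaOne * u - S.kappa * v) -
          (S.averagedField z u v ⬝ᵥ (H *ᵥ z) + z ⬝ᵥ (H *ᵥ S.averagedField z u v)))) ∧
      (∀ (z : Fin m → ℝ) (u v : ℝ),
        S.averagedField z u v ⬝ᵥ (H *ᵥ z) + z ⬝ᵥ (H *ᵥ S.averagedField z u v) ≤
          K * (z ⬝ᵥ (H *ᵥ z) + u ^ 2 + v ^ 2)) ∧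
      (∀ z : Fin m → ℝ, ‖z‖ ^ 2 ≤ b * (z ⬝ᵥ (H *ᵥ z))) ∧
      (∀ z : Fin m → ℝ, z ⬝ᵥ (H *ᵥ z) ≤ b * ‖z‖ ^ 2) := by
  have hN : (Matrix.fromBlocks H (Matrix.of ![0, 0, 0])ᵀ (Matrix.of ![0, 0, 0]) 1 :
      Matrix (Fin m ⊕ Fin 3) (Fin m ⊕ Fin 3) ℝ).PosDef := by
    refine Matrix.PosDef.of_dotProduct_mulVec_pos ?_ ?_
    · refine IsHermitian.fromBlocks hH.1 ?_ isHermitian_one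
      simp
    · intro x hx
      obtain ⟨z, r, rfl⟩ : ∃ z r, x = Sum.elim z r := ⟨_, _, (Sum.elim_comp_inl_inr x).symm⟩
      have hr : r = ![r 0, r 1, r 2] := by ext i; fin_cases i <;> rfl
      rw [star_trivial, hr, bordered_form]
      simp only [zero_dotProduct, mul_zero, add_zero, one_mulVec, vec3_dotProduct]
      simp only [Matrix.cons_val]
      rcases eq_or_ne z 0 with rfl | hz
      · have hr0 : r ≠ 0 := by
          rintro rfl
          exact hx (by ext i; cases i <;> rfl)
        simp only [zero_dotProduct, zero_add]
        by_contra hneg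
        refine hr0 ?_
        have h0 : r 0 = 0 := by nlinarith [sq_nonneg (r 0), sq_nonneg (r 1), sq_nonneg (r 2)]
        have h1 : r 1 = 0 := by nlinarith [sq_nonneg (r 0), sq_nonneg (r 1), sq_nonneg (r 2)]
        have h2 : r 2 = 0 := by nlinarith [sq_nonneg (r 0), sq_nonneg (r 1), sq_nonneg (r 2)]
        rw [hr, h0, h1, h2]
        ext i; fin_cases i <;> rfl
      · have := hH.dotProduct_mulVec_pos hz
        rw [star_trivial] at this
        nlinarith [sq_nonneg (r 0), sq_nonneg (r 1), sq_nonneg (r 2)]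
  obtain ⟨c, hc, hcb⟩ := hQ.exists_form_le
    (Matrix.fromBlocks H (Matrix.of ![0, 0, 0])ᵀ (Matrix.of ![0, 0, 0]) (Matrix.diagonal ![0, 1, 0]))
  obtain ⟨K, hK, hKb⟩ := hN.exists_form_le (S.lmiL H)
  obtain ⟨b₁, hb₁, hbb₁⟩ := hH.exists_form_le 1
  obtain ⟨b₂, hb₂, hbb₂⟩ := (Matrix.PosDef.one (n := Fin m) (R := ℝ)).exists_form_le H
  -- The factor `m` passes from the Euclidean norm to the sup norm; `b₁` keeps the maximum positive
  -- even when `m = 0`.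
  refine ⟨c, hc, K, hK, max b₁ (b₂ * m), lt_max_of_lt_left hb₁, ?_, ?_, ?_, ?_⟩
  · intro z u v w
    have h := hcb (Sum.elim z ![u, v, w])
    rw [sub_mulVec, dotProduct_sub, lmiR_form, lmiL_form, bordered_form] at h
    simp only [zero_dotProduct, mul_zero, add_zero, vec3_dotProduct, mulVec_diagonal] at h
    simp only [Matrix.cons_val, zero_mul, one_mul, mul_zero, zero_add, add_zero] at h
    rw [← sq] at h
    exact h
  · intro z u v
    have h := hKb (Sum.elim z ![u, v, 0])
    rw [lmiL_form, bordered_form] at h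
    simp only [zero_dotProduct, mul_zero, add_zero, vec3_dotProduct, one_mulVec] at h
    simp only [Matrix.cons_val, mul_zero, add_zero] at h
    refine h.trans_eq ?_
    ring
  · intro z
    have hpos : 0 ≤ z ⬝ᵥ (H *ᵥ z) := by simpa using hH.posSemidef.dotProduct_mulVec_nonneg z
    have h : ‖z‖ ^ 2 ≤ z ⬝ᵥ z := by
      have h0 : 0 ≤ z ⬝ᵥ z := by simpa using dotProduct_star_self_nonneg z
      rw [← Real.le_sqrt (norm_nonneg _) h0, pi_norm_le_iff_of_nonneg (Real.sqrt_nonneg _)]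
      intro i
      refine Real.le_sqrt_of_sq_le ?_
      rw [Real.norm_eq_abs, sq_abs, sq]
      exact Finset.single_le_sum (f := fun i => z i * z i) (fun j _ => mul_self_nonneg _)
        (Finset.mem_univ i)
    have h2 := hbb₁ z
    rw [one_mulVec] at h2
    exact (h.trans h2).trans (mul_le_mul_of_nonneg_right (le_max_left _ _) hpos)
  · intro z
    have h := hbb₂ z
    rw [one_mulVec] at h
    have h2 : z ⬝ᵥ z ≤ m * ‖z‖ ^ 2 := by
      have : z ⬝ᵥ z ≤ ∑ _i : Fin m, ‖z‖ ^ 2 := Finset.sum_le_sum fun i _ => by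
        rw [← sq, ← sq_abs]
        exact pow_le_pow_left₀ (abs_nonneg _) (norm_le_pi_norm z i) 2
      simpa using this
    calc z ⬝ᵥ (H *ᵥ z) ≤ b₂ * (m * ‖z‖ ^ 2) := h.trans (mul_le_mul_of_nonneg_left h2 hb₂.le)
      _ = (b₂ * m) * ‖z‖ ^ 2 := by ring
      _ ≤ _ := mul_le_mul_of_nonneg_right (le_max_right _ _) (sq_nonneg _)

/-! ### Integral estimates over one period -/

/-- The averaged inequality over one period of the quadratic form of `lmiR`, in which the last
variable has been chosen as `-κ₂ ġ / ε`. -/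
theorem integral_form_nonpos {T ε ν κ ρ v s₀ : ℝ} (hT : 0 < T) (hε : 0 < ε) (hν : 0 < ν)
    {g g' u : ℝ → ℝ} (hg : ContinuousOn g (Icc 0 T)) (hg' : ContinuousOn g' (Icc 0 T))
    (hu : ContinuousOn u (Icc 0 T))
    (hd : ∀ t ∈ Ioo 0 T, HasDerivWithinAt g (g' t) (Ici t) t)
    (hu2 : ∫ t in 0..T, u t ^ 2 ≤ T ^ 3 / 3 * v ^ 2) (hs₀ : s₀ ∈ Icc 0 T)
    (hv : (ρ - κ) * v ^ 2 ≤ v * g s₀) :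
    ∫ t in 0..T, (3 * ν / T ^ 2 * u t ^ 2 - v * g t + (ρ - ν - ε - κ) * v ^ 2 -
      (T / Real.pi) ^ 2 / ε * g' t ^ 2) ≤ 0 := by
  have hW := integral_sq_le_wirtinger hT hs₀ (g := fun t => g t - g s₀) (g' := g')
    (by fun_prop) hg' (fun t ht => (hd t ht).sub_const _) (sub_self _)
  have hint : ∀ f : ℝ → ℝ, ContinuousOn f (Icc 0 T) →
      IntervalIntegrable f MeasureTheory.volume 0 T := fun f hf => hf.intervalIntegrable_of_Icc hT.le
  have hpt := integral_mono_of_continuousOn hT.le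
    (f := fun t => 3 * ν / T ^ 2 * u t ^ 2 - v * g t + (ρ - ν - ε - κ) * v ^ 2 -
      (T / Real.pi) ^ 2 / ε * g' t ^ 2)
    (g := fun t => 3 * ν / T ^ 2 * u t ^ 2 + (1 / (4 * ε)) * (g t - g s₀) ^ 2 -
      (T / Real.pi) ^ 2 / ε * g' t ^ 2 - ν * v ^ 2) (by fun_prop) (by fun_prop) (fun t _ => by
        -- Young's inequality uses up the `ε` in the coefficient of `v²`. The weight `1/(4ε)` times
        -- the Wirtinger constant `(2T/π)²` is `κ₂²/ε`, which explains the value of `κ₂`.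
        have h : -(v * (g t - g s₀)) ≤ ε * v ^ 2 + 1 / (4 * ε) * (g t - g s₀) ^ 2 := by
          have : ε * v ^ 2 + 1 / (4 * ε) * (g t - g s₀) ^ 2 + v * (g t - g s₀) =
            (2 * ε * v + (g t - g s₀)) ^ 2 / (4 * ε) := by
              field_simp
              ring
          have h2 : 0 ≤ (2 * ε * v + (g t - g s₀)) ^ 2 / (4 * ε) := by positivity
          linarith
        nlinarith)
  refine hpt.trans ?_
  rw [intervalIntegral.integral_sub (hint _ (by fun_prop)) (hint _ (by fun_prop)),
    intervalIntegral.integral_sub (hint _ (by fun_prop)) (hint _ (by fun_prop)),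
    intervalIntegral.integral_add (hint _ (by fun_prop)) (hint _ (by fun_prop)),
    intervalIntegral.integral_const_mul, intervalIntegral.integral_const_mul,
    intervalIntegral.integral_const_mul, intervalIntegral.integral_const]
  have h1 : 3 * ν / T ^ 2 * ∫ t in 0..T, u t ^ 2 ≤ T * (ν * v ^ 2) := by
    refine (mul_le_mul_of_nonneg_left hu2 (by positivity)).trans_eq ?_
    field_simp
  have h2 : 1 / (4 * ε) * ∫ t in 0..T, (g t - g s₀) ^ 2 ≤
      (T / Real.pi) ^ 2 / ε * ∫ t in 0..T, g' t ^ 2 := by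
    refine (mul_le_mul_of_nonneg_left hW (by positivity)).trans_eq ?_
    rw [← mul_assoc]
    congr 1
    field_simp
    ring
  rw [sub_zero, smul_eq_mul]
  linarith

end PWMSystem

/-- Decay over one period of a nonnegative function `V` that is controlled by its integral. -/
theorem decay_of_integral_le {T c K d : ℝ} (hT : 0 < T) (hc : 0 < c) (hK : 0 < K) (hd0 : 0 ≤ d)
    {V V' : ℝ → ℝ} (hV0 : ∀ t, 0 ≤ V t) (hV : ContinuousOn V (Icc 0 T))
    (hV' : ContinuousOn V' (Icc 0 T))
    (hd : ∀ t ∈ Ioo 0 T, HasDerivWithinAt V (V' t) (Ici t) t)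
    (hI : ∫ t in 0..T, (V t + d) ≤ c * (V 0 - V T)) (hle : ∀ t ∈ Icc 0 T, V' t ≤ K * (V t + d)) :
    V T ≤ (1 + T * K) * c / (T + (1 + T * K) * c) * V 0 ∧
      (∀ t ∈ Icc 0 T, V t ≤ (1 + K * c) * V 0) ∧ T * d ≤ c * V 0 := by
  refine ⟨?_, ?_, ?_⟩
  · have h1 := integral_rightDeriv_eq_sub (f := fun t => t * V t) (f' := fun t => V t + t * V' t)
      hT.le (by fun_prop) (by fun_prop) (fun t ht => by
        have := ((hasDerivAt_id t).hasDerivWithinAt (s := Ici t)).fun_mul (hd t ht)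
        simpa using this)
    have h2 := integral_mono_of_continuousOn hT.le (f := fun t => V t + t * V' t)
      (g := fun t => (1 + T * K) * (V t + d)) (by fun_prop) (by fun_prop) (fun t ht => by
        have h3 := mul_le_mul_of_nonneg_left (hle t ht) ht.1
        have h4 : t * (K * (V t + d)) ≤ T * (K * (V t + d)) :=
          mul_le_mul_of_nonneg_right ht.2 (by have := hV0 t; positivity)
        linarith)
    rw [h1, intervalIntegral.integral_const_mul, zero_mul, sub_zero] at h2
    have h3 := h2.trans (mul_le_mul_of_nonneg_left hI (by positivity))
    rw [div_mul_eq_mul_div, le_div_iff₀ (by positivity)]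
    linarith
  · intro t ht
    have hsub : Icc 0 t ⊆ Icc 0 T := Icc_subset_Icc_right ht.2
    have h1 := integral_rightDeriv_eq_sub ht.1 (hV.mono hsub) (hV'.mono hsub)
      (fun s hs => hd s ⟨hs.1, hs.2.trans_le ht.2⟩)
    have h2 := integral_mono_of_continuousOn ht.1 (f := V') (g := fun t => K * (V t + d))
      (hV'.mono hsub) ((by fun_prop : ContinuousOn (fun t => K * (V t + d)) (Icc 0 T)).mono hsub)
      (fun s hs => hle s (hsub hs))
    have h3 : ∫ s in 0..t, (V s + d) ≤ ∫ s in 0..T, (V s + d) := by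
      refine intervalIntegral.integral_mono_interval le_rfl ht.1 ht.2
        (MeasureTheory.ae_of_all _ fun s => add_nonneg (hV0 s) hd0) ?_
      exact ContinuousOn.intervalIntegrable_of_Icc hT.le (by fun_prop)
    rw [h1, intervalIntegral.integral_const_mul] at h2
    have h4 := mul_le_mul_of_nonneg_left (h3.trans hI) hK.le
    have h5 : 0 ≤ K * (c * V T) := by have := hV0 T; positivity
    linarith
  · have h1 := integral_mono_of_continuousOn hT.le (f := fun _ => d) (g := fun t => V t + d)
      (by fun_prop) (by fun_prop) (fun t _ => by linarith [hV0 t])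
    rw [intervalIntegral.integral_const, sub_zero, smul_eq_mul] at h1
    nlinarith [hV0 T]

theorem hasDerivWithinAt_dotProduct_mulVec {m : ℕ} (H : Matrix (Fin m) (Fin m) ℝ)
    {z : ℝ → Fin m → ℝ} {z' : Fin m → ℝ} {s : Set ℝ} {t : ℝ} (h : HasDerivWithinAt z z' s t) :
    HasDerivWithinAt (fun r => z r ⬝ᵥ (H *ᵥ z r)) (z' ⬝ᵥ (H *ᵥ z t) + z t ⬝ᵥ (H *ᵥ z')) s t := by
  have hz := hasDerivWithinAt_pi.1 h
  have h1 : ∀ i, HasDerivWithinAt (fun r => (H *ᵥ z r) i) ((H *ᵥ z') i) s t := fun i => by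
    simp only [mulVec, dotProduct]
    exact HasDerivWithinAt.fun_sum fun j _ => (hz j).const_mul _
  simp only [dotProduct, ← Finset.sum_add_distrib]
  exact HasDerivWithinAt.fun_sum fun i _ => (hz i).fun_mul (h1 i)

theorem hasDerivWithinAt_const_dotProduct {m : ℕ} (C : Fin m → ℝ)
    {z : ℝ → Fin m → ℝ} {z' : Fin m → ℝ} {s : Set ℝ} {t : ℝ} (h : HasDerivWithinAt z z' s t) :
    HasDerivWithinAt (fun r => C ⬝ᵥ z r) (C ⬝ᵥ z') s t := by
  simp only [dotProduct]
  exact HasDerivWithinAt.fun_sum fun i _ => (hasDerivWithinAt_pi.1 h i).const_mul _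

/-! ### The modulator and its sector condition -/

namespace PWMSystem
variable {m : ℕ} (S : PWMSystem m)

theorem pulseWidth_mem_Icc {σ : ℝ → ℝ} (hσ : ContinuousOn σ (Ici 0)) (n : ℕ) :
    S.pulseWidth σ n ∈ Icc 0 S.T := by
  by_cases h0 : σ (n * S.T) ≤ S.σ₁
  · rw [pulseWidth, if_pos h0]
    exact ⟨le_rfl, S.T_pos.le⟩
  by_cases h1 : ∀ s ∈ Icc 0 S.T, S.ramp s < σ (n * S.T + s)
  · rw [pulseWidth, if_neg h0, if_pos h1]
    exact ⟨S.T_pos.le, le_rfl⟩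
  · exact (S.pulseWidth_isLeast σ hσ n h0 h1).1.1

/-- The inequality survives saturation at `T`, where the crossing equation may fail; the next lemma
does the same for width `0`. -/
theorem ramp_le_of_pulseWidth_pos {σ : ℝ → ℝ} (hσ : ContinuousOn σ (Ici 0)) {n : ℕ}
    (h : 0 < S.pulseWidth σ n) :
    S.ramp (S.pulseWidth σ n) ≤ σ (n * S.T + S.pulseWidth σ n) := by
  by_cases h0 : σ (n * S.T) ≤ S.σ₁
  · rw [pulseWidth, if_pos h0] at h
    exact absurd h (lt_irrefl _)
  by_cases h1 : ∀ s ∈ Icc 0 S.T, S.ramp s < σ (n * S.T + s)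
  · exact (h1 _ (S.pulseWidth_mem_Icc hσ n)).le
  · exact (S.pulseWidth_isLeast σ hσ n h0 h1).1.2.ge

theorem le_ramp_of_pulseWidth_lt {σ : ℝ → ℝ} (hσ : ContinuousOn σ (Ici 0)) {n : ℕ}
    (h : S.pulseWidth σ n < S.T) :
    σ (n * S.T + S.pulseWidth σ n) ≤ S.ramp (S.pulseWidth σ n) := by
  by_cases h0 : σ (n * S.T) ≤ S.σ₁
  · rw [pulseWidth, if_pos h0]
    simpa [ramp] using h0
  by_cases h1 : ∀ s ∈ Icc 0 S.T, S.ramp s < σ (n * S.T + s)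
  · rw [pulseWidth, if_neg h0, if_pos h1] at h
    exact absurd h (lt_irrefl _)
  · exact (S.pulseWidth_isLeast σ hσ n h0 h1).1.2.le

theorem modulator_add (σ : ℝ → ℝ) (n : ℕ) {s : ℝ} (hs : s ∈ Ico 0 S.T) :
    S.modulator σ (n * S.T + s) = if s < S.pulseWidth σ n then 1 else 0 := by
  have hfl : ⌊(n * S.T + s) / S.T⌋₊ = n := by
    have hT := S.T_pos
    rw [Nat.floor_eq_iff (by have := hs.1; positivity), le_div_iff₀ hT, div_lt_iff₀ hT]
    constructor <;> linarith [hs.1, hs.2]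
  simp only [modulator, hfl, add_lt_add_iff_left]

theorem hasDerivWithinAt_comp_const_add_Ici {E : Type*} [NormedAddCommGroup E] [NormedSpace ℝ E]
    {f : ℝ → E} {f' : E} {a s : ℝ} (h : HasDerivWithinAt f f' (Ici (a + s)) (a + s)) :
    HasDerivWithinAt (fun r => f (a + r)) f' (Ici s) s := by
  have h1 : HasDerivWithinAt (fun r => a + r) 1 (Ici s) s :=
    ((hasDerivAt_id s).const_add a).hasDerivWithinAt
  have h2 := h.scomp s h1 (fun r hr => add_le_add_right hr a)
  rwa [one_smul] at h2

variable {S}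

theorem IsSolution.continuousOn_input {x : ℝ → Fin m → ℝ} (hx : S.IsSolution x) :
    ContinuousOn (S.input x) (Ici 0) := by
  have := continuousOn_pi.1 hx.continuousOn
  unfold input dotProduct
  fun_prop

theorem IsSolution.continuousOn_comp_add {x : ℝ → Fin m → ℝ} (hx : S.IsSolution x) (n : ℕ) :
    ContinuousOn (fun s => x (n * S.T + s)) (Icc 0 S.T) :=
  hx.continuousOn.comp (by fun_prop) fun s hs =>
    add_nonneg (mul_nonneg n.cast_nonneg S.T_pos.le) hs.1

/-- Between the switching instants the modulator input is Lipschitz with constant any bound for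
its derivative. -/
theorem IsSolution.abs_input_sub_le {x : ℝ → Fin m → ℝ} (hx : S.IsSolution x) {L : ℝ}
    (hbound : ∀ t, 0 < t → ∀ d, HasDerivAt (S.input x) d t → |d| ≤ L) {n : ℕ} {a b : ℝ}
    (ha : 0 ≤ a) (hab : a ≤ b) (hb : b ≤ S.T)
    (hsw : b ≤ S.pulseWidth (S.input x) n ∨ S.pulseWidth (S.input x) n ≤ a) :
    |S.input x (n * S.T + b) - S.input x (n * S.T + a)| ≤ L * (b - a) := by
  have hn : (0 : ℝ) ≤ n * S.T := mul_nonneg n.cast_nonneg S.T_pos.le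
  -- The interval lies on one side of the switching instant, so the pulse is constant on `[a, b)`
  -- and the velocity extends continuously to `b`.
  obtain ⟨f, hf⟩ : ∃ f : ℝ, ∀ s ∈ Ico a b, S.modulator (S.input x) (n * S.T + s) = f := by
    rcases hsw with h | h
    · refine ⟨1, fun s hs => ?_⟩
      rw [S.modulator_add _ _ ⟨ha.trans hs.1, hs.2.trans_le hb⟩, if_pos (hs.2.trans_le h)]
    · refine ⟨0, fun s hs => ?_⟩
      rw [S.modulator_add _ _ ⟨ha.trans hs.1, hs.2.trans_le hb⟩, if_neg (h.trans hs.1).not_gt]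
  have hsub : Icc (n * S.T + a) (n * S.T + b) ⊆ Ici 0 := fun t ht =>
    (add_nonneg hn ha).trans ht.1
  set g' : ℝ → ℝ := fun t => S.C ⬝ᵥ (S.A *ᵥ x t + f • S.B + S.q) with hg'
  have hc : ContinuousOn g' (Icc (n * S.T + a) (n * S.T + b)) := by
    have := continuousOn_pi.1 (hx.continuousOn.mono hsub)
    simp only [hg', dotProduct, mulVec, Pi.add_apply]
    fun_prop
  have hd : ∀ t ∈ Ioo (n * S.T + a) (n * S.T + b),
      HasDerivWithinAt (S.input x) (g' t) (Ici t) t := by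
    intro t ht
    have h := hx.hasDeriv t (hsub ⟨ht.1.le, ht.2.le⟩)
    have hm := hf (t - n * S.T) ⟨by linarith [ht.1], by linarith [ht.2]⟩
    rw [add_sub_cancel] at hm
    rw [hm] at h
    exact (hasDerivWithinAt_const_dotProduct S.C h).add_const _
  have hci := hx.continuousOn_input.mono hsub
  have hle : n * S.T + a ≤ n * S.T + b := by linarith
  rw [← integral_rightDeriv_eq_sub hle hci hc hd]
  -- The hypothesis bounds two-sided derivatives only; they exist here because the right derivative
  -- is continuous.
  have hg'b : ∀ t ∈ Ioo (n * S.T + a) (n * S.T + b), |g' t| ≤ L := fun t ht =>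
    hbound t ((add_nonneg hn ha).trans_lt ht.1) _
      (hasDerivAt_of_continuousOn_rightDeriv hci hc hd ht)
  have h := intervalIntegral.norm_integral_le_of_norm_le_const_ae (f := g') (C := L)
    (a := n * S.T + a) (b := n * S.T + b) (by
      have hne : ∀ᵐ t : ℝ, t ≠ n * S.T + b := by simp [MeasureTheory.ae_iff]
      filter_upwards [hne] with t ht hmem
      rw [uIoc_of_le hle] at hmem
      exact hg'b t ⟨hmem.1, lt_of_le_of_ne hmem.2 ht⟩)
  rw [Real.norm_eq_abs, add_sub_add_left_eq_sub, abs_of_nonneg (sub_nonneg.2 hab)] at h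
  exact h

/-- Between the ends of the two pulses the ramp rises by `σs |v|`, while `σ⁰` changes by at most `L
T |v|`, since its own switching is at an end of that interval. Evaluating both inputs at the end of
the `x` pulse means that no bound on the derivative of `S.input x` is needed. -/
theorem IsSolution.pulse_sector {x x₀ : ℝ → Fin m → ℝ} (hx : S.IsSolution x)
    (hx₀ : S.IsSolution x₀) {L : ℝ}
    (hbound : ∀ t, 0 < t → ∀ d, HasDerivAt (S.input x₀) d t → |d| ≤ L) (n : ℕ) {τ v : ℝ}
    (hτ : τ = S.pulseWidth (S.input x) n)
    (hv : v = (τ - S.pulseWidth (S.input x₀) n) / S.T) :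
    (S.σs - S.T * L) * v ^ 2 ≤ v * (S.input x (n * S.T + τ) - S.input x₀ (n * S.T + τ)) := by
  have hT := S.T_pos
  obtain ⟨ha, hb⟩ := S.pulseWidth_mem_Icc hx.continuousOn_input n
  obtain ⟨ha₀, hb₀⟩ := S.pulseWidth_mem_Icc hx₀.continuousOn_input n
  have hup := S.ramp_le_of_pulseWidth_pos hx.continuousOn_input (n := n)
  have hdn := S.le_ramp_of_pulseWidth_lt hx.continuousOn_input (n := n)
  have hup₀ := S.ramp_le_of_pulseWidth_pos hx₀.continuousOn_input (n := n)
  have hdn₀ := S.le_ramp_of_pulseWidth_lt hx₀.continuousOn_input (n := n)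
  rw [← hτ] at ha hb hup hdn
  have hLip := fun {a b : ℝ} h1 h2 h3 h4 => hx₀.abs_input_sub_le hbound (n := n) (a := a) (b := b)
    h1 h2 h3 h4
  generalize S.pulseWidth (S.input x₀) n = τ₀ at *
  have hr : S.ramp τ - S.ramp τ₀ = S.σs * v := by
    rw [ramp, ramp, hv]
    ring
  have hTv : τ - τ₀ = S.T * v := by
    rw [hv]
    field_simp
  rcases lt_trichotomy τ₀ τ with h | h | h
  · have hv0 : 0 < v := by rw [hv]; exact div_pos (sub_pos.2 h) hT
    have h1 := (le_abs_self _).trans (hLip ha₀ h.le hb (Or.inr le_rfl))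
    have h2 := hup (ha₀.trans_lt h)
    have h3 := hdn₀ (h.trans_le hb)
    have h4 : (S.σs - S.T * L) * v ≤ S.input x (n * S.T + τ) - S.input x₀ (n * S.T + τ) := by
      rw [hTv] at h1
      linarith
    nlinarith
  · have hv0 : v = 0 := by rw [hv, h, sub_self, zero_div]
    simp [hv0]
  · have hv0 : v < 0 := by rw [hv]; exact div_neg_of_neg_of_pos (sub_neg.2 h) hT
    have h1 := (le_abs_self _).trans (hLip ha h.le hb₀ (Or.inl le_rfl))
    have h2 := hup₀ (ha.trans_lt h)
    have h3 := hdn (h.trans_le hb₀)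
    have h4 : S.input x (n * S.T + τ) - S.input x₀ (n * S.T + τ) ≤ (S.σs - S.T * L) * v := by
      have : τ₀ - τ = -(S.T * v) := by linarith
      rw [this] at h1
      linarith
    nlinarith

/-! ### Decay of the smoothed difference -/

/-- The smoothed difference of two solutions on the `n`-th period. -/
noncomputable def smoothedDiff (S : PWMSystem m) (x x₀ : ℝ → Fin m → ℝ) (n : ℕ) (s : ℝ) :
    Fin m → ℝ :=
  x (n * S.T + s) - x₀ (n * S.T + s) -
    pulseRipple S.T (S.pulseWidth (S.input x) n) (S.pulseWidth (S.input x₀) n) s • S.B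

theorem IsSolution.continuousOn_smoothedDiff {x x₀ : ℝ → Fin m → ℝ} (hx : S.IsSolution x)
    (hx₀ : S.IsSolution x₀) (n : ℕ) : ContinuousOn (S.smoothedDiff x x₀ n) (Icc 0 S.T) :=
  ((hx.continuousOn_comp_add n).sub (hx₀.continuousOn_comp_add n)).sub
    ((continuous_pulseRipple _ _ _).continuousOn.smul continuousOn_const)

/-- Subtracting the ripple leaves only the mean `v` of the pulse difference, so the velocity has no
jumps inside the period; the price is the term `u A B`. -/
theorem IsSolution.hasDerivWithinAt_smoothedDiff {x x₀ : ℝ → Fin m → ℝ} (hx : S.IsSolution x)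
    (hx₀ : S.IsSolution x₀) (n : ℕ) {s : ℝ} (hs : s ∈ Ico 0 S.T) :
    HasDerivWithinAt (S.smoothedDiff x x₀ n)
      (S.averagedField (S.smoothedDiff x x₀ n s)
        (pulseRipple S.T (S.pulseWidth (S.input x) n) (S.pulseWidth (S.input x₀) n) s)
        ((S.pulseWidth (S.input x) n - S.pulseWidth (S.input x₀) n) / S.T)) (Ici s) s := by
  have hn : (0 : ℝ) ≤ n * S.T + s := add_nonneg (mul_nonneg n.cast_nonneg S.T_pos.le) hs.1
  have h1 := hasDerivWithinAt_comp_const_add_Ici (hx.hasDeriv _ hn)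
  have h2 := hasDerivWithinAt_comp_const_add_Ici (hx₀.hasDeriv _ hn)
  have h3 := (hasDerivWithinAt_pulseRipple S.T (S.pulseWidth (S.input x) n)
    (S.pulseWidth (S.input x₀) n) s).smul_const S.B
  rw [S.modulator_add _ _ hs] at h1 h2
  refine ((h1.fun_sub h2).fun_sub h3).congr_deriv ?_
  simp only [averagedField, smoothedDiff, mulVec_sub, mulVec_smul]
  module

theorem IsSolution.smoothedDiff_zero {x x₀ : ℝ → Fin m → ℝ} (hx : S.IsSolution x)
    (hx₀ : S.IsSolution x₀) (n : ℕ) :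
    S.smoothedDiff x x₀ n 0 = x (n * S.T) - x₀ (n * S.T) := by
  rw [smoothedDiff, pulseRipple_zero (S.pulseWidth_mem_Icc hx.continuousOn_input n).1
    (S.pulseWidth_mem_Icc hx₀.continuousOn_input n).1, zero_smul, sub_zero, add_zero]

theorem IsSolution.smoothedDiff_period {x x₀ : ℝ → Fin m → ℝ} (hx : S.IsSolution x)
    (hx₀ : S.IsSolution x₀) (n : ℕ) :
    S.smoothedDiff x x₀ n S.T = S.smoothedDiff x x₀ (n + 1) 0 := by
  rw [smoothedDiff_zero hx hx₀, smoothedDiff, pulseRipple_period S.T_pos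
    (S.pulseWidth_mem_Icc hx.continuousOn_input n).2
    (S.pulseWidth_mem_Icc hx₀.continuousOn_input n).2, zero_smul, sub_zero]
  push_cast
  rw [add_one_mul]

/-- The linear matrix inequality forces a quadratic Lyapunov function to decay geometrically from
period to period along the difference of two solutions. -/
theorem exists_period_decay {L₁ : ℝ} {H : Matrix (Fin m) (Fin m) ℝ} {ε ν : ℝ}
    (hQ : (S.lmiR L₁ ε ν - S.lmiL H).PosDef) (hH : H.PosDef) (hν : 0 < ν) (hε : 0 < ε) :
    ∃ r, 0 ≤ r ∧ r < 1 ∧ ∃ M > 0, ∀ x x₀ : ℝ → Fin m → ℝ, S.IsSolution x → S.IsSolution x₀ →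
      (∀ t, 0 < t → ∀ d, HasDerivAt (S.input x₀) d t → |d| ≤ L₁) → ∀ n : ℕ,
      (S.smoothedDiff x x₀ (n + 1) 0 ⬝ᵥ (H *ᵥ S.smoothedDiff x x₀ (n + 1) 0) ≤
        r * (S.smoothedDiff x x₀ n 0 ⬝ᵥ (H *ᵥ S.smoothedDiff x x₀ n 0))) ∧
      (∀ s ∈ Icc 0 S.T, S.smoothedDiff x x₀ n s ⬝ᵥ (H *ᵥ S.smoothedDiff x x₀ n s) ≤
        M * (S.smoothedDiff x x₀ n 0 ⬝ᵥ (H *ᵥ S.smoothedDiff x x₀ n 0))) ∧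
      ((S.pulseWidth (S.input x) n - S.pulseWidth (S.input x₀) n) / S.T) ^ 2 ≤
        M * (S.smoothedDiff x x₀ n 0 ⬝ᵥ (H *ᵥ S.smoothedDiff x x₀ n 0)) := by
  obtain ⟨c, hc, K, hK, -, -, hcb, hKb, -, -⟩ := S.exists_lyapunov_bounds hH hQ
  have hT := S.T_pos
  -- The factor `1 + T²` absorbs `u²` through `|u| ≤ T |v|`.
  set K' := K * (1 + S.T ^ 2) with hK'
  have hK'0 : 0 < K' := by positivity
  have ha : 0 < (1 + S.T * K') * c := by positivity
  refine ⟨(1 + S.T * K') * c / (S.T + (1 + S.T * K') * c), by positivity,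
    (div_lt_one (by positivity)).2 (by linarith), max (1 + K' * c) (c / S.T),
    lt_max_of_lt_left (by positivity), fun x x₀ hx hx₀ hbound n => ?_⟩
  have hHnn : ∀ z : Fin m → ℝ, 0 ≤ z ⬝ᵥ (H *ᵥ z) := fun z => by
    simpa using hH.posSemidef.dotProduct_mulVec_nonneg z
  have hmem := S.pulseWidth_mem_Icc hx.continuousOn_input n
  have hmem₀ := S.pulseWidth_mem_Icc hx₀.continuousOn_input n
  have hsec := hx.pulse_sector hx₀ hbound n rfl rfl
  have hzc := hx.continuousOn_smoothedDiff hx₀ n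
  have hzd := fun s hs => hx.hasDerivWithinAt_smoothedDiff hx₀ n (s := s) hs
  rw [← hx.smoothedDiff_period hx₀ n]
  have hyz : S.input x (n * S.T + S.pulseWidth (S.input x) n) -
      S.input x₀ (n * S.T + S.pulseWidth (S.input x) n) =
      S.C ⬝ᵥ S.smoothedDiff x x₀ n (S.pulseWidth (S.input x) n) -
        pulseRipple S.T (S.pulseWidth (S.input x) n) (S.pulseWidth (S.input x₀) n)
          (S.pulseWidth (S.input x) n) * S.kappa := by
    simp only [smoothedDiff, input, dotProduct_sub, dotProduct_smul, kappa, smul_eq_mul]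
    ring
  rw [hyz] at hsec
  generalize S.pulseWidth (S.input x) n = τ at *
  generalize S.pulseWidth (S.input x₀) n = τ₀ at *
  generalize S.smoothedDiff x x₀ n = z at *
  have huc := continuous_pulseRipple S.T τ τ₀
  have hub : ∀ s ∈ Icc 0 S.T, |pulseRipple S.T τ τ₀ s| ≤ S.T * |(τ - τ₀) / S.T| :=
    fun s hs => abs_pulseRipple_le hT hs
  have hu2 := integral_sq_pulseRipple_le hT τ τ₀
  generalize pulseRipple S.T τ τ₀ = u at *
  generalize (τ - τ₀) / S.T = v at *
  have hzi := continuousOn_pi.1 hzc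
  have hfc : ContinuousOn (fun s => S.averagedField (z s) (u s) v) (Icc 0 S.T) := by
    refine continuousOn_pi.2 fun i => ?_
    simp only [averagedField, mulVec, dotProduct, Pi.add_apply, Pi.smul_apply, smul_eq_mul]
    fun_prop
  have hfi := continuousOn_pi.1 hfc
  have hV : ContinuousOn (fun s => z s ⬝ᵥ (H *ᵥ z s)) (Icc 0 S.T) := by
    simp only [mulVec, dotProduct]
    fun_prop
  have hV' : ContinuousOn (fun s => S.averagedField (z s) (u s) v ⬝ᵥ (H *ᵥ z s) +
      z s ⬝ᵥ (H *ᵥ S.averagedField (z s) (u s) v)) (Icc 0 S.T) := by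
    simp only [mulVec, dotProduct]
    fun_prop
  have hg : ContinuousOn (fun s => S.C ⬝ᵥ z s) (Icc 0 S.T) := by
    simp only [dotProduct]
    fun_prop
  have hg' : ContinuousOn (fun s => S.C ⬝ᵥ S.averagedField (z s) (u s) v) (Icc 0 S.T) := by
    simp only [dotProduct]
    fun_prop
  have hVd : ∀ s ∈ Ioo 0 S.T, HasDerivWithinAt (fun s => z s ⬝ᵥ (H *ᵥ z s))
      (S.averagedField (z s) (u s) v ⬝ᵥ (H *ᵥ z s) +
      z s ⬝ᵥ (H *ᵥ S.averagedField (z s) (u s) v)) (Ici s) s := fun s hs =>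
    hasDerivWithinAt_dotProduct_mulVec H (hzd s ⟨hs.1.le, hs.2⟩)
  -- The reference instant is the end of the `x` pulse. Passing from the inputs to `C z` there costs
  -- `v u κ`, at most `T |κ| v²`.
  have hform := integral_form_nonpos (ρ := S.σs - S.T * L₁) (κ := S.T * |S.kappa|) hT hε hν hg hg'
    huc.continuousOn (fun s hs => hasDerivWithinAt_const_dotProduct S.C (hzd s ⟨hs.1.le, hs.2⟩))
    hu2 hmem (by
      have h1 : v * (u τ * S.kappa) ≥ -(S.T * |S.kappa| * v ^ 2) := by
        have h2 : |v * (u τ * S.kappa)| ≤ |v| * (S.T * |v| * |S.kappa|) := by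
          rw [abs_mul, abs_mul]
          exact mul_le_mul_of_nonneg_left
            (mul_le_mul_of_nonneg_right (hub τ hmem) (abs_nonneg _)) (abs_nonneg _)
        have h3 : |v| * (S.T * |v| * |S.kappa|) = S.T * |S.kappa| * v ^ 2 := by
          rw [← sq_abs v]
          ring
        rw [h3] at h2
        exact (abs_le.1 h2).1
      nlinarith)
  have hFTC := integral_rightDeriv_eq_sub hT.le hV hV' hVd
  have hI : ∫ s in 0..S.T, (z s ⬝ᵥ (H *ᵥ z s) + v ^ 2) ≤
      c * (z 0 ⬝ᵥ (H *ᵥ z 0) - z S.T ⬝ᵥ (H *ᵥ z S.T)) := by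
    have h1 := integral_mono_of_continuousOn hT.le
      (f := fun s => z s ⬝ᵥ (H *ᵥ z s) + v ^ 2)
      (g := fun s => c * ((3 * ν / S.T ^ 2 * u s ^ 2 - v * (S.C ⬝ᵥ z s) +
        (S.σs - S.T * L₁ - ν - ε - S.T * |S.kappa|) * v ^ 2 -
        (S.T / Real.pi) ^ 2 / ε * (S.C ⬝ᵥ S.averagedField (z s) (u s) v) ^ 2) -
        (S.averagedField (z s) (u s) v ⬝ᵥ (H *ᵥ z s) +
          z s ⬝ᵥ (H *ᵥ S.averagedField (z s) (u s) v)))) (by fun_prop) (by fun_prop)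
      (fun s _ => by
        -- This `w` minimises `ε w² + 2 κ₂ w g'`, with minimum `-κ₂² g'²/ε`.
        have h := hcb (z s) (u s) v (-(S.kappaTwo * (S.C ⬝ᵥ S.averagedField (z s) (u s) v)) / ε)
        have e : S.C ⬝ᵥ (S.A *ᵥ z s) - S.kappaOne * u s - S.kappa * v =
            S.C ⬝ᵥ S.averagedField (z s) (u s) v := by
          simp only [averagedField, dotProduct_add, dotProduct_smul, kappa, kappaOne, smul_eq_mul]
          ring
        rw [e] at h
        refine h.trans_eq ?_
        rw [kappaTwo]
        congr 2
        field_simp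
        ring)
    rw [intervalIntegral.integral_const_mul, intervalIntegral.integral_sub, hFTC] at h1
    · refine h1.trans (mul_le_mul_of_nonneg_left ?_ hc.le)
      linarith
    · exact ContinuousOn.intervalIntegrable_of_Icc hT.le (by fun_prop)
    · exact hV'.intervalIntegrable_of_Icc hT.le
  obtain ⟨d1, d2, d3⟩ := decay_of_integral_le hT hc hK'0 (sq_nonneg v) (fun s => hHnn (z s))
    hV hV' hVd hI (fun s hs => by
      refine (hKb (z s) (u s) v).trans ?_
      have h1 : u s ^ 2 ≤ S.T ^ 2 * v ^ 2 := by
        have := pow_le_pow_left₀ (abs_nonneg _) (hub s hs) 2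
        rwa [mul_pow, sq_abs, sq_abs] at this
      rw [hK', mul_assoc]
      refine mul_le_mul_of_nonneg_left ?_ hK.le
      nlinarith [mul_nonneg (sq_nonneg S.T) (hHnn (z s))])
  refine ⟨d1, fun s hs => (d2 s hs).trans
    (mul_le_mul_of_nonneg_right (le_max_left _ _) (hHnn _)), ?_⟩
  have h1 : v ^ 2 ≤ c / S.T * (z 0 ⬝ᵥ (H *ᵥ z 0)) := by
    rw [div_mul_eq_mul_div, le_div_iff₀ hT]
    linarith
  exact h1.trans (mul_le_mul_of_nonneg_right (le_max_right _ _) (hHnn _))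

/-- Exponential estimate for the difference of two solutions and of their pulse widths. -/
theorem exists_exponential_estimate {L₁ : ℝ} {H : Matrix (Fin m) (Fin m) ℝ} {ε ν : ℝ}
    (hQ : (S.lmiR L₁ ε ν - S.lmiL H).PosDef) (hH : H.PosDef) (hν : 0 < ν) (hε : 0 < ε) :
    ∃ ρ, 0 ≤ ρ ∧ ρ < 1 ∧ ∃ M > 0, ∀ x x₀ : ℝ → Fin m → ℝ, S.IsSolution x → S.IsSolution x₀ →
      (∀ t, 0 < t → ∀ d, HasDerivAt (S.input x₀) d t → |d| ≤ L₁) →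
      (∀ t, 0 ≤ t → ‖x t - x₀ t‖ ≤ M * ρ ^ ⌊t / S.T⌋₊ * ‖x 0 - x₀ 0‖) ∧
      ∀ n : ℕ, |S.pulseWidth (S.input x) n - S.pulseWidth (S.input x₀) n| ≤
        M * ρ ^ n * ‖x 0 - x₀ 0‖ := by
  obtain ⟨-, -, -, -, b, hb, -, -, hb1, hb2⟩ := S.exists_lyapunov_bounds hH hQ
  obtain ⟨r, hr0, hr1, M, hM, hdec⟩ := exists_period_decay hQ hH hν hε
  have hT := S.T_pos
  have hHnn : ∀ z : Fin m → ℝ, 0 ≤ z ⬝ᵥ (H *ᵥ z) := fun z => by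
    simpa using hH.posSemidef.dotProduct_mulVec_nonneg z
  set D := Real.sqrt M * Real.sqrt b with hD
  have hD0 : 0 < D := by positivity
  -- The root appears because `V` is quadratic in the deviation. The summands `√b`, `T‖B‖`, `T`
  -- account for `z`, the ripple and the pulse width.
  refine ⟨Real.sqrt r, Real.sqrt_nonneg r, (Real.sqrt_lt' one_pos).2 (by simpa using hr1),
    D * (Real.sqrt b + S.T * ‖S.B‖ + S.T), by positivity, fun x x₀ hx hx₀ hbound => ?_⟩
  have hdec := hdec x x₀ hx hx₀ hbound
  set V : ℕ → ℝ := fun n => S.smoothedDiff x x₀ n 0 ⬝ᵥ (H *ᵥ S.smoothedDiff x x₀ n 0) with hVdef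
  have hVn : ∀ n, V n ≤ r ^ n * (b * ‖x 0 - x₀ 0‖ ^ 2) := by
    intro n
    induction n with
    | zero =>
      have h := hb2 (S.smoothedDiff x x₀ 0 0)
      have e : S.smoothedDiff x x₀ 0 0 = x 0 - x₀ 0 := by
        rw [hx.smoothedDiff_zero hx₀]
        simp
      rw [hVdef]
      simp only [e, pow_zero, one_mul] at h ⊢
      exact h
    | succ n ih =>
      refine (hdec n).1.trans ((mul_le_mul_of_nonneg_left ih hr0).trans_eq ?_)
      ring
  set a : ℕ → ℝ := fun n => D * Real.sqrt r ^ n * ‖x 0 - x₀ 0‖ with ha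
  have ha0 : ∀ n, 0 ≤ a n := fun n => by positivity
  have hMV : ∀ n, M * V n ≤ a n ^ 2 := by
    intro n
    refine (mul_le_mul_of_nonneg_left (hVn n) hM.le).trans_eq ?_
    rw [ha, hD]
    simp only [mul_pow, ← pow_mul, mul_comm n 2]
    rw [pow_mul, Real.sq_sqrt hr0, Real.sq_sqrt hM.le, Real.sq_sqrt hb.le]
    ring
  have hv : ∀ n, |(S.pulseWidth (S.input x) n - S.pulseWidth (S.input x₀) n) / S.T| ≤ a n :=
    fun n => abs_le_of_sq_le_sq ((hdec n).2.2.trans (hMV n)) (ha0 n)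
  have hz : ∀ n, ∀ s ∈ Icc 0 S.T, ‖S.smoothedDiff x x₀ n s‖ ≤ Real.sqrt b * a n := by
    intro n s hs
    refine le_of_sq_le_sq ?_ (by have := ha0 n; positivity)
    rw [mul_pow, Real.sq_sqrt hb.le]
    exact (hb1 _).trans (mul_le_mul_of_nonneg_left (((hdec n).2.1 s hs).trans (hMV n)) hb.le)
  constructor
  · intro t ht
    set n := ⌊t / S.T⌋₊ with hn
    have hmem : t - n * S.T ∈ Icc 0 S.T := by
      have h1 := Nat.floor_le (div_nonneg ht hT.le)
      have h2 := Nat.lt_floor_add_one (t / S.T)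
      rw [le_div_iff₀ hT] at h1
      rw [div_lt_iff₀ hT] at h2
      constructor <;> linarith
    have e : x t - x₀ t = S.smoothedDiff x x₀ n (t - n * S.T) +
        pulseRipple S.T (S.pulseWidth (S.input x) n) (S.pulseWidth (S.input x₀) n)
          (t - n * S.T) • S.B := by
      rw [smoothedDiff, add_sub_cancel, sub_add_cancel]
    rw [e]
    refine (norm_add_le _ _).trans ?_
    rw [norm_smul, Real.norm_eq_abs]
    have h1 := hz n _ hmem
    have h2 := mul_le_mul_of_nonneg_right ((abs_pulseRipple_le hT hmem).trans
      (mul_le_mul_of_nonneg_left (hv n) hT.le)) (norm_nonneg S.B)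
    have h3 : D * (Real.sqrt b + S.T * ‖S.B‖ + S.T) * Real.sqrt r ^ n * ‖x 0 - x₀ 0‖ =
      Real.sqrt b * a n + S.T * a n * ‖S.B‖ + S.T * a n := by
        rw [ha]
        ring
    rw [h3]
    have h4 : 0 ≤ S.T * a n := mul_nonneg hT.le (ha0 n)
    linarith [h1, h2]
  · intro n
    have h1 := hv n
    rw [abs_div, abs_of_pos hT, div_le_iff₀ hT] at h1
    refine h1.trans ?_
    have h2 : 0 ≤ (Real.sqrt b + S.T * ‖S.B‖) * a n := by have := ha0 n; positivity
    have h3 : D * (Real.sqrt b + S.T * ‖S.B‖ + S.T) * Real.sqrt r ^ n * ‖x 0 - x₀ 0‖ =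
      (Real.sqrt b + S.T * ‖S.B‖) * a n + a n * S.T := by
        rw [ha]
        ring
    linarith

theorem pulseWidth_of_periodic {x : ℝ → Fin m → ℝ} (hper : ∀ t, 0 ≤ t → x (t + S.T) = x t)
    (n : ℕ) : S.pulseWidth (S.input x) n = S.pulseWidth (S.input x) 0 := by
  have hT := S.T_pos
  have hx : ∀ k : ℕ, ∀ s, 0 ≤ s → x (k * S.T + s) = x s := by
    intro k s hs
    induction k with
    | zero => simp
    | succ k ih =>
      rw [← ih, ← hper (k * S.T + s) (by positivity)]
      congr 1
      push_cast
      ring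
  have h1 : ∀ s, 0 ≤ s → S.input x (n * S.T + s) = S.input x s := fun s hs => by
    rw [input, input, hx n s hs]
  have h0 : S.input x (n * S.T) = S.input x 0 := by simpa using h1 0 le_rfl
  have h2 : {s | s ∈ Icc 0 S.T ∧ S.input x (n * S.T + s) = S.ramp s} =
      {s | s ∈ Icc 0 S.T ∧ S.input x s = S.ramp s} := by
    ext s
    exact and_congr_right fun hs => by rw [h1 s hs.1]
  have h3 : (∀ s ∈ Icc 0 S.T, S.ramp s < S.input x (n * S.T + s)) ↔
      ∀ s ∈ Icc 0 S.T, S.ramp s < S.input x s :=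
    forall₂_congr fun s hs => by rw [h1 s hs.1]
  unfold pulseWidth
  classical
  exact if_congr (by simp [h0]) rfl
    (if_congr (by simpa using h3) rfl (by simpa using congrArg sInf h2))

end PWMSystem

theorem theorem2 {m : ℕ} (S : PWMSystem m)
    -- a `T`-periodic solution `x⁰`
    (x₀ : ℝ → Fin m → ℝ) (hx₀ : S.IsSolution x₀) (hper : ∀ t, 0 ≤ t → x₀ (t + S.T) = x₀ t)
    -- the bound on the derivative of `σ⁰`, wherever this derivative exists
    (L₁ : ℝ) (hL₁ : 0 < L₁)
    (hbound : ∀ t, 0 < t → ∀ d, HasDerivAt (S.input x₀) d t → |d| ≤ L₁)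
    -- feasibility of the linear matrix inequalities
    (hLMI : ∃ (H : Matrix (Fin m) (Fin m) ℝ) (ε ν : ℝ),
      (S.lmiR L₁ ε ν - S.lmiL H).PosDef ∧ H.PosDef ∧ 0 < ν ∧ 0 < ε) :
    (∀ x, S.IsSolution x →
      Tendsto (fun t => x t - x₀ t) atTop (𝓝 0) ∧
      Tendsto (fun n : ℕ => S.pulseWidth (S.input x) n) atTop
        (𝓝 (S.pulseWidth (S.input x₀) 0))) ∧
    S.LyapunovStable x₀ := by
  obtain ⟨H, ε, ν, hQ, hH, hν, hε⟩ := hLMI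
  obtain ⟨ρ, hρ0, hρ1, M, hM, hest⟩ := PWMSystem.exists_exponential_estimate hQ hH hν hε
  have hpow : ∀ k : ℝ, Tendsto (fun n : ℕ => M * ρ ^ n * k) atTop (𝓝 0) := fun k => by
    simpa using ((tendsto_pow_atTop_nhds_zero_of_lt_one hρ0 hρ1).const_mul M).mul_const k
  refine ⟨fun x hx => ?_, fun η hη => ⟨η / M, by positivity, fun x hx h0 t ht => ?_⟩⟩
  · obtain ⟨h1, h2⟩ := hest x x₀ hx hx₀ hbound
    constructor
    · have hfl : Tendsto (fun t : ℝ => ⌊t / S.T⌋₊) atTop atTop :=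
        tendsto_nat_floor_atTop.comp (tendsto_id.atTop_div_const S.T_pos)
      refine squeeze_zero_norm' ?_ ((hpow ‖x 0 - x₀ 0‖).comp hfl)
      filter_upwards [eventually_ge_atTop 0] with t ht
      exact h1 t ht
    · rw [tendsto_iff_norm_sub_tendsto_zero]
      refine squeeze_zero (fun _ => norm_nonneg _) (fun n => ?_) (hpow ‖x 0 - x₀ 0‖)
      rw [← PWMSystem.pulseWidth_of_periodic hper n]
      exact h2 n
  · refine ((hest x x₀ hx hx₀ hbound).1 t ht).trans_lt ?_
    have h3 : M * ρ ^ ⌊t / S.T⌋₊ ≤ M := mul_le_of_le_one_right hM.le (pow_le_one₀ hρ0 hρ1.le)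
    calc _ ≤ M * ‖x 0 - x₀ 0‖ := mul_le_mul_of_nonneg_right h3 (norm_nonneg _)
      _ < η := by rwa [lt_div_iff₀' hM] at h0
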